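/- Let $\mathcal A_0\subset\mathbb R^2$ be a measurable set (the reference geometry of the sensor array) with finite, nonzero area $|\mathcal A_0|$, and put $$\mathcal G_{1,1}(\xi_1,\xi_2,\xi_3,\xi_4)=\frac1{|\mathcal A_0|}\int_{\mathcal A_0}\exp\Bigl(-i(u_1\xi_1+u_2\xi_2)-i\frac{u_1^2+u_2^2}{2}\xi_3-i\frac{u_1^2+u_2^2}{2}\xi_4\Bigr)\,du_1\,du_2 .$$ Let $a_0,\omega_0,B_H,c_0,t_g>0$ (normalized array radius, central frequency, bandwidth, true wave speed, prescribed travel time), let $z_g=(0,0,c_0t_g)$ be the virtual guide star, and let $F_0\in L^2(\mathbb R)$ be a (real- or complex-valued) function that is not almost everywhere zero. For a backpropagation speed $c_s>0$ and the search point $z_s(c_s,t_g)=(0,0,c_st_g)$, let the second moment of the imaging functional $\mathcal I$ be given by the narrowband formula $$\mathbb E\bigl|\mathcal I(z_s(c_s,t_g),c_s)\bigr|^2=\kappa\int_{\mathbb R^3}\Bigl|F_0\Bigl(\tfrac{B_H}{c_0}\bigl(2\eta_3+\tfrac{\eta_1^2+\eta_2^2}{|z_g|}\bigr)\Bigr)\Bigr|^2\,\Bigl|\mathcal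 G_{1,1}\Bigl(\tfrac{a_0\omega_0}{c_0|z_g|}\eta_1,\tfrac{a_0\omega_0}{c_0|z_g|}\eta_2,0,\tfrac{-a_0^2\omega_0}{c_0|z_g|}\bigl(\bigl(\tfrac{c_0}{c_s}\bigr)^2-1\bigr)\Bigr)\Bigr|^4\,d\eta_1\,d\eta_2\,d\eta_3 ,$$ where $\kappa>0$ does not depend on $c_s$. Then the integral is finite for every $c_s>0$, and the true speed is the unique maximizer of the second moment over $c_s>0$: $$c_0=\operatorname*{arg\,max}_{c_s>0}\ \mathbb E\bigl|\mathcal I(z_s(c_s,t_g),c_s)\bigr|^2 .$$ -/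

import Mathlib

open MeasureTheory

noncomputable section

namespace DaylightImaging

/-- The normalized point spread function `𝒢_{α_r, α_f}(ξ₁, ξ₂, ξ₃, ξ₄)` of a planar sensor array
with reference geometry `A₀ ⊆ ℝ²`. -/
def pointSpread (A₀ : Set (EuclideanSpace ℝ (Fin 2))) (α_r α_f ξ₁ ξ₂ ξ₃ ξ₄ : ℝ) : ℂ :=
  (1 / (volume.real A₀ : ℂ)) * ∫ u in A₀,
    Complex.exp
      (-Complex.I * ((α_f * u 0 * ξ₁ + u 1 * ξ₂ : ℝ) : ℂ)
        - Complex.I * (((u 0 ^ 2 * α_r ^ 2 + u 1 ^ 2) / 2 * ξ₃ : ℝ) : ℂ)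
        - Complex.I * (((u 0 ^ 2 + u 1 ^ 2) / 2 * ξ₄ : ℝ) : ℂ))

/-- The physical location `z_g = (0, 0, c₀ t_g)` of the virtual guide star with travel
time `t_g`. -/
def guideStar (c₀ t_g : ℝ) : EuclideanSpace ℝ (Fin 3) := !₂[0, 0, c₀ * t_g]

/-- The integrand of the narrowband second-moment formula. The variable `η = (η₁, η₂, η₃) ∈ ℝ³`
is split into its transverse part `η.1 = (η₁, η₂)` and its range component `η.2 = η₃`. -/
def momentIntegrand (A₀ : Set (EuclideanSpace ℝ (Fin 2))) (F₀ : ℝ → ℂ)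
    (a₀ ω₀ B_H c₀ t_g c_s : ℝ) (η : EuclideanSpace ℝ (Fin 2) × ℝ) : ℝ :=
  ‖F₀ (B_H / c₀ * (2 * η.2 + (η.1 0 ^ 2 + η.1 1 ^ 2) / ‖guideStar c₀ t_g‖))‖ ^ 2 *
    ‖pointSpread A₀ 1 1
        (a₀ * ω₀ / (c₀ * ‖guideStar c₀ t_g‖) * η.1 0)
        (a₀ * ω₀ / (c₀ * ‖guideStar c₀ t_g‖) * η.1 1)
        0
        (-a₀ ^ 2 * ω₀ / (c₀ * ‖guideStar c₀ t_g‖) * ((c₀ / c_s) ^ 2 - 1))‖ ^ 4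

/-- The narrowband formula for the second moment `𝔼 |ℐ(z_s(c_s, t_g), c_s)|²` of the imaging
functional at the search point `z_s(c_s, t_g) = (0, 0, c_s t_g)`, as a function of the
backpropagation speed `c_s`. The factor `κ` is the proportionality constant, independent of `c_s`,
up to which the formula is given. -/
def secondMoment (κ : ℝ) (A₀ : Set (EuclideanSpace ℝ (Fin 2))) (F₀ : ℝ → ℂ)
    (a₀ ω₀ B_H c₀ t_g c_s : ℝ) : ℝ :=
  κ * ∫ η : EuclideanSpace ℝ (Fin 2) × ℝ, momentIntegrand A₀ F₀ a₀ ω₀ B_H c₀ t_g c_s η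

/-- The set of all maximizers of `f` over `s`. -/
def argmaxOn (f : ℝ → ℝ) (s : Set ℝ) : Set ℝ := {x | x ∈ s ∧ IsMaxOn f s x}

end DaylightImaging

end

/-! Up to scaling, the point spread function is the Fourier transform of the indicator of `A₀` times
the phase `exp(-i s |u|²/2)`, where the rate `s` vanishes, among positive speeds, exactly at `c_s =
c₀`. A shear in the range variable separates the integrand, so the second moment is a positive
constant times the fourth power of the `L⁴` norm of that transform.

The fourth power of a modulus is the squared modulus of the transform of a self-convolution, so
Plancherel turns this into the squared `L²` norm of `chirpConv A₀ s`. At each `x` that convolution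
integrates a unimodular function over the overlap of `A₀` with `x - A₀`: its modulus is at most the
area of the overlap, which is its value at `s = 0`. For `s ≠ 0` the bound is strict wherever the
overlap has positive area (`norm_chirpConv_lt`), and such `x` have positive measure because the
overlap areas integrate to `|A₀|²`. -/

section Plancherel

open FourierTransform SchwartzMap
open scoped ContDiff

variable {E : Type*} [NormedAddCommGroup E] [InnerProductSpace ℝ E] [FiniteDimensional ℝ E]
  [MeasurableSpace E] [BorelSpace E]

theorem continuous_fourier_of_integrable {f : E → ℂ} (hf : Integrable f) : Continuous (𝓕 f) :=
  VectorFourier.fourierIntegral_continuous Real.continuous_fourierChar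
    (by exact continuous_inner) hf

/-- The `L²` Fourier transform of a function in `L¹ ∩ L²` is given by the Fourier integral. -/
theorem coeFn_fourier_toLp_ae_eq {f : E → ℂ} (hf : Integrable f) (hf2 : MemLp f 2) :
    (𝓕 (hf2.toLp f) : Lp (α := E) ℂ 2) =ᵐ[volume] 𝓕 f := by
  apply ae_eq_of_integral_contDiff_smul_eq
  · exact (Lp.memLp _).locallyIntegrable (by norm_num)
  · exact (continuous_fourier_of_integrable hf).locallyIntegrable
  · intro g g_smooth g_cpt
    have hg₁ : HasCompactSupport (Complex.ofRealCLM ∘ g) := g_cpt.comp_left rfl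
    have hg₂ : ContDiff ℝ ∞ (Complex.ofRealCLM ∘ g) := by fun_prop
    set φ : 𝓢(E, ℂ) := hg₁.toSchwartzMap hg₂ with hφ
    have hφx : ∀ x, φ x = (g x : ℂ) := fun x => by simp [hφ]
    -- The `L²` transform is the distributional one, so testing against `φ` moves the transform onto
    -- `φ`; `h3` does the same for the Fourier integral.
    have h := congrArg (fun T => T φ) (Lp.fourier_toTemperedDistribution_eq (hf2.toLp f))
    simp only [TemperedDistribution.fourier_apply, Lp.toTemperedDistribution_apply] at h
    have h2 : ∫ x, (𝓕 φ : 𝓢(E, ℂ)) x • hf2.toLp f x = ∫ x, (𝓕 φ : 𝓢(E, ℂ)) x • f x :=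
      integral_congr_ae (by filter_upwards [hf2.coeFn_toLp] with x hx; rw [hx])
    have h3 : ∫ ξ, 𝓕 (φ : E → ℂ) ξ • f ξ = ∫ x, φ x • 𝓕 f x := by
      have := VectorFourier.integral_fourierIntegral_smul_eq_flip (μ := volume) (ν := volume)
        (L := innerₗ E) Real.continuous_fourierChar
        (by exact continuous_inner) φ.integrable hf
      rw [flip_innerₗ] at this
      exact this
    rw [h2] at h
    simp only [hφx, Complex.coe_smul, SchwartzMap.fourier_coe] at h h3
    rw [← h, ← h3]

/-- The Fourier integral of a function in `L¹ ∩ L²` is square integrable. -/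
theorem memLp_two_fourier {f : E → ℂ} (hf : Integrable f) (hf2 : MemLp f 2) :
    MemLp (𝓕 f) 2 volume :=
  (memLp_congr_ae (coeFn_fourier_toLp_ae_eq hf hf2)).1 (Lp.memLp _)

theorem integral_norm_sq_eq_toReal_eLpNorm_sq {f : E → ℂ} (hf : MemLp f 2) :
    ∫ x, ‖f x‖ ^ 2 = (eLpNorm f 2 volume).toReal ^ 2 := by
  rw [hf.eLpNorm_eq_integral_rpow_norm (by norm_num) (by norm_num),
    ENNReal.toReal_ofReal (by positivity), ← Real.rpow_natCast _ 2, ← Real.rpow_mul (by positivity)]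
  simp

/-- **Plancherel's theorem** for functions in `L¹ ∩ L²`. -/
theorem integral_norm_fourier_sq {f : E → ℂ} (hf : Integrable f) (hf2 : MemLp f 2) :
    ∫ x, ‖𝓕 f x‖ ^ 2 = ∫ x, ‖f x‖ ^ 2 := by
  rw [integral_norm_sq_eq_toReal_eLpNorm_sq hf2,
    integral_norm_sq_eq_toReal_eLpNorm_sq (memLp_two_fourier hf hf2),
    ← eLpNorm_congr_ae (coeFn_fourier_toLp_ae_eq hf hf2), ← Lp.norm_def, Lp.norm_fourier_eq,
    Lp.norm_toLp]

end Plancherel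

/-! ### Self-convolution of a truncated quadratic phase, and the `L⁴` comparison -/

section Chirp

open FourierTransform Convolution

variable {E : Type*} [NormedAddCommGroup E] [InnerProductSpace ℝ E]

/-- The quadratic phase of rate `s`, truncated to the set `A`. -/
noncomputable def chirp (A : Set E) (s : ℝ) : E → ℂ :=
  A.indicator fun u => Complex.exp ((-(‖u‖ ^ 2 / 2 * s) : ℝ) * Complex.I)

variable [FiniteDimensional ℝ E] [MeasurableSpace E] [BorelSpace E] {A : Set E}

theorem integrable_chirp (hA : MeasurableSet A) (hA_fin : volume A ≠ ⊤) (s : ℝ) :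
    Integrable (chirp A s) := by
  have : Continuous fun u : E => Complex.exp ((-(‖u‖ ^ 2 / 2 * s) : ℝ) * Complex.I) := by fun_prop
  refine (integrable_indicator_iff hA).2 (IntegrableOn.of_bound hA_fin.lt_top
    this.aestronglyMeasurable 1 (ae_of_all _ fun u => ?_))
  exact (Complex.norm_exp_ofReal_mul_I _).le

theorem memLp_two_of_integrable_of_norm_le {f : E → ℂ} (hf : Integrable f) {C : ℝ}
    (hC : ∀ x, ‖f x‖ ≤ C) : MemLp f 2 := by
  refine (memLp_two_iff_integrable_sq_norm hf.1).2
    ((hf.norm.const_mul C).mono' (hf.1.norm.pow 2) (ae_of_all _ fun x => ?_))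
  rw [Real.norm_of_nonneg (by positivity), sq]
  exact mul_le_mul_of_nonneg_right (hC x) (norm_nonneg _)

/-- The self-convolution of the truncated quadratic phase. -/
noncomputable def chirpConv (A : Set E) (s : ℝ) : E → ℂ :=
  chirp A s ⋆[ContinuousLinearMap.mul ℂ ℂ, volume] chirp A s

theorem chirpConv_apply (hA : MeasurableSet A) (s : ℝ) (x : E) :
    chirpConv A s x = ∫ t in A ∩ (x - ·) ⁻¹' A,
      Complex.exp ((-((‖t‖ ^ 2 + ‖x - t‖ ^ 2) / 2 * s) : ℝ) * Complex.I) := by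
  rw [← integral_indicator (hA.inter (hA.preimage (by fun_prop)))]
  refine integral_congr_ae (ae_of_all _ fun t => ?_)
  by_cases h1 : t ∈ A
  · by_cases h2 : x - t ∈ A
    · rw [Set.indicator_of_mem (by exact ⟨h1, h2⟩)]
      simp only [chirp, ContinuousLinearMap.mul_apply', Set.indicator_of_mem h1,
        Set.indicator_of_mem h2, ← Complex.exp_add]
      congr 1
      push_cast
      ring
    · rw [Set.indicator_of_notMem (by exact fun h => h2 h.2)]
      simp [chirp, h2]
  · rw [Set.indicator_of_notMem (by exact fun h => h1 h.1)]
    simp [chirp, h1]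

theorem chirpConv_zero_apply (hA : MeasurableSet A) (x : E) :
    chirpConv A 0 x = (volume.real (A ∩ (x - ·) ⁻¹' A) : ℂ) := by
  simp [chirpConv_apply hA]

theorem norm_chirpConv_le (hA : MeasurableSet A) (hA_fin : volume A ≠ ⊤) (s : ℝ) (x : E) :
    ‖chirpConv A s x‖ ≤ volume.real (A ∩ (x - ·) ⁻¹' A) := by
  rw [chirpConv_apply hA]
  refine (norm_setIntegral_le_of_norm_le_const (C := 1)
    (measure_lt_top_of_subset Set.inter_subset_left hA_fin) fun t _ => ?_).trans_eq (one_mul _)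
  exact (Complex.norm_exp_ofReal_mul_I _).le

/-- By the parallelogram identity the phase depends on `t` only through `‖t - x/2‖`, so a level set
lies in a sphere centred at `x/2`. `Nontrivial E` makes even the sphere of radius zero null. -/
theorem volume_setOf_quadraticPhase_eq [Nontrivial E] {s : ℝ} (hs : s ≠ 0) (x : E) (r : ℝ) :
    volume {t : E | -((‖t‖ ^ 2 + ‖x - t‖ ^ 2) / 2 * s) = r} = 0 := by
  refine measure_mono_null (fun t ht => ?_)
    (Measure.addHaar_sphere volume ((1 / 2 : ℝ) • x) √(-r / s - ‖x‖ ^ 2 / 4))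
  have h1 : ‖t - (1 / 2 : ℝ) • x‖ ^ 2 = -r / s - ‖x‖ ^ 2 / 4 := by
    have hr : -r / s = (‖t‖ ^ 2 + ‖x - t‖ ^ 2) / 2 := by
      rw [← show _ = r from ht]; field_simp
    rw [hr, norm_sub_sq_real, norm_sub_sq_real, norm_smul, inner_smul_right, real_inner_comm]
    norm_num
    ring
  rw [mem_sphere_iff_norm, ← h1, Real.sqrt_sq (norm_nonneg _)]

theorem norm_chirpConv_lt [Nontrivial E] (hA : MeasurableSet A) (hA_fin : volume A ≠ ⊤) {s : ℝ}
    (hs : s ≠ 0) {x : E} (hx : volume.real (A ∩ (x - ·) ⁻¹' A) ≠ 0) :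
    ‖chirpConv A s x‖ < volume.real (A ∩ (x - ·) ⁻¹' A) := by
  set B := A ∩ (x - ·) ⁻¹' A with hB
  have hB_fin : volume B ≠ ⊤ := (measure_lt_top_of_subset Set.inter_subset_left hA_fin).ne
  have hB_pos : volume B ≠ 0 := fun h => hx (by simp [Measure.real, h])
  set φ : E → ℝ := fun t => -((‖t‖ ^ 2 + ‖x - t‖ ^ 2) / 2 * s) with hφ
  -- Equality in the triangle inequality would force the exponential to be a.e. constant on `B`,
  -- hence `φ` constant modulo `2π`; then countably many null level sets would cover almost all of
  -- `B`.
  have h := ae_eq_const_or_norm_setIntegral_lt_of_norm_le_const (μ := volume) (t := B)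
    (f := fun t => Complex.exp (φ t * Complex.I)) (C := 1) hB_fin
    (ae_of_all _ fun t => (Complex.norm_exp_ofReal_mul_I _).le)
  rw [chirpConv_apply hA]
  refine (h.resolve_left fun hc => ?_).trans_eq (mul_one _)
  have : Filter.NeBot (ae (volume.restrict B)) := by
    rw [ae_neBot]; exact fun h0 => hB_pos (Measure.restrict_eq_zero.1 h0)
  obtain ⟨t₀, ht₀⟩ := hc.exists
  have hsub : ∀ᵐ t ∂volume.restrict B, t ∈ ⋃ n : ℤ, {t | φ t = φ t₀ + n * (2 * Real.pi)} := by
    filter_upwards [hc] with t ht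
    obtain ⟨n, hn⟩ := Complex.exp_eq_exp_iff_exists_int.1 (ht.trans ht₀.symm)
    refine Set.mem_iUnion.2 ⟨n, ?_⟩
    have h2 : (φ t : ℂ) * Complex.I = ((φ t₀ + n * (2 * Real.pi) : ℝ) : ℂ) * Complex.I := by
      rw [hn]; push_cast; ring
    exact_mod_cast mul_right_cancel₀ Complex.I_ne_zero h2
  have hnull : volume (⋃ n : ℤ, {t | φ t = φ t₀ + n * (2 * Real.pi)}) = 0 :=
    measure_iUnion_null fun n => volume_setOf_quadraticPhase_eq hs x _
  have hnull' : ∀ᵐ t ∂volume.restrict B, t ∉ ⋃ n : ℤ, {t | φ t = φ t₀ + n * (2 * Real.pi)} :=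
    ae_restrict_of_ae (measure_eq_zero_iff_ae_notMem.1 hnull)
  obtain ⟨t, h1, h2⟩ := (hsub.and hnull').exists
  exact h2 h1

theorem integrable_chirpConv (hA : MeasurableSet A) (hA_fin : volume A ≠ ⊤) (s : ℝ) :
    Integrable (chirpConv A s) :=
  (integrable_chirp hA hA_fin s).integrable_convolution _ (integrable_chirp hA hA_fin s)

theorem memLp_two_chirpConv (hA : MeasurableSet A) (hA_fin : volume A ≠ ⊤) (s : ℝ) :
    MemLp (chirpConv A s) 2 :=
  memLp_two_of_integrable_of_norm_le (integrable_chirpConv hA hA_fin s) fun x =>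
    (norm_chirpConv_le hA hA_fin s x).trans (measureReal_mono Set.inter_subset_left hA_fin)

theorem norm_fourier_chirp_pow_four (hA : MeasurableSet A) (hA_fin : volume A ≠ ⊤) (s : ℝ)
    (ξ : E) : ‖𝓕 (chirp A s) ξ‖ ^ 4 = ‖𝓕 (chirpConv A s) ξ‖ ^ 2 := by
  rw [chirpConv, Real.fourier_mul_convolution_eq (integrable_chirp hA hA_fin s)
    (integrable_chirp hA hA_fin s), norm_mul]
  ring

theorem integrable_norm_fourier_chirp_pow_four (hA : MeasurableSet A) (hA_fin : volume A ≠ ⊤)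
    (s : ℝ) : Integrable fun ξ => ‖𝓕 (chirp A s) ξ‖ ^ 4 := by
  simp only [norm_fourier_chirp_pow_four hA hA_fin]
  have h := memLp_two_fourier (integrable_chirpConv hA hA_fin s) (memLp_two_chirpConv hA hA_fin s)
  exact (memLp_two_iff_integrable_sq_norm h.1).1 h

theorem integral_norm_fourier_chirp_pow_four (hA : MeasurableSet A) (hA_fin : volume A ≠ ⊤)
    (s : ℝ) : ∫ ξ, ‖𝓕 (chirp A s) ξ‖ ^ 4 = ∫ x, ‖chirpConv A s x‖ ^ 2 := by
  simp only [norm_fourier_chirp_pow_four hA hA_fin]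
  exact integral_norm_fourier_sq (integrable_chirpConv hA hA_fin s)
    (memLp_two_chirpConv hA hA_fin s)

/-- Guarantees that the overlap is not a.e. null, which the strict `L⁴` inequality needs. -/
theorem integral_volumeReal_inter_preimage (hA : MeasurableSet A) (hA_fin : volume A ≠ ⊤) :
    ∫ x, volume.real (A ∩ (x - ·) ⁻¹' A) = volume.real A ^ 2 := by
  have h1 : ∫ u, chirp A 0 u = (volume.real A : ℂ) := by
    simp [chirp, integral_indicator hA]
  have h := integral_convolution (ContinuousLinearMap.mul ℂ ℂ) (integrable_chirp hA hA_fin 0)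
    (integrable_chirp hA hA_fin 0)
  change ∫ x, chirpConv A 0 x = _ at h
  simp only [chirpConv_zero_apply hA, h1, ContinuousLinearMap.mul_apply'] at h
  rw [sq]
  exact_mod_cast h

/-- The `L⁴` norm of the Fourier transform of a truncated quadratic phase is largest when the
phase vanishes, and only then. -/
theorem integral_norm_fourier_chirp_pow_four_lt [Nontrivial E] (hA : MeasurableSet A)
    (hA_pos : volume A ≠ 0) (hA_fin : volume A ≠ ⊤) {s : ℝ} (hs : s ≠ 0) :
    ∫ ξ, ‖𝓕 (chirp A s) ξ‖ ^ 4 < ∫ ξ, ‖𝓕 (chirp A 0) ξ‖ ^ 4 := by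
  rw [integral_norm_fourier_chirp_pow_four hA hA_fin,
    integral_norm_fourier_chirp_pow_four hA hA_fin]
  have h0 : ∀ x, ‖chirpConv A 0 x‖ = volume.real (A ∩ (x - ·) ⁻¹' A) := fun x => by
    rw [chirpConv_zero_apply hA, Complex.norm_real, Real.norm_of_nonneg measureReal_nonneg]
  have hint := fun s => (memLp_two_iff_integrable_sq_norm
    (memLp_two_chirpConv hA hA_fin s).1).1 (memLp_two_chirpConv hA hA_fin s)
  have hle : ∀ x, ‖chirpConv A s x‖ ^ 2 ≤ ‖chirpConv A 0 x‖ ^ 2 := fun x => by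
    rw [h0]
    gcongr
    exact norm_chirpConv_le hA hA_fin s x
  refine (integral_mono (hint s) (hint 0) hle).lt_of_ne fun heq => ?_
  have hae : ∀ᵐ x, volume.real (A ∩ (x - ·) ⁻¹' A) = 0 := by
    filter_upwards [(integral_eq_iff_of_ae_le (hint s) (hint 0) (ae_of_all _ hle)).1 heq]
      with x hx
    by_contra hne
    have hlt := norm_chirpConv_lt hA hA_fin hs hne
    rw [← h0, ← pow_lt_pow_iff_left₀ (norm_nonneg _) (norm_nonneg _) two_ne_zero] at hlt
    exact hlt.ne hx
  have h := integral_volumeReal_inter_preimage hA hA_fin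
  rw [integral_congr_ae hae, integral_zero, eq_comm, sq_eq_zero_iff,
    measureReal_eq_zero_iff hA_fin] at h
  exact hA_pos h

end Chirp

/-! ### Reduction of the second moment to the `L⁴` norm -/

namespace DaylightImaging

open FourierTransform

/-- The factor `2π` comes from the kernel `exp(-2πi⟨u, ξ⟩)` of `𝓕`. -/
theorem pointSpread_eq_fourier_chirp {A₀ : Set (EuclideanSpace ℝ (Fin 2))}
    (hA₀ : MeasurableSet A₀) (k s : ℝ) (η : EuclideanSpace ℝ (Fin 2)) :
    pointSpread A₀ 1 1 (k * η 0) (k * η 1) 0 s =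
      (1 / (volume.real A₀ : ℂ)) * 𝓕 (chirp A₀ s) ((k / (2 * Real.pi)) • η) := by
  rw [pointSpread, Real.fourier_eq', ← integral_indicator hA₀]
  congr 2
  ext u
  by_cases hu : u ∈ A₀
  · simp only [chirp, Set.indicator_of_mem hu, smul_eq_mul, ← Complex.exp_add]
    congr 1
    rw [EuclideanSpace.real_norm_sq_eq, PiLp.inner_apply]
    simp only [Fin.sum_univ_two, PiLp.smul_apply, RCLike.inner_apply, conj_trivial, smul_eq_mul]
    push_cast
    have : (Real.pi : ℂ) ≠ 0 := by exact_mod_cast Real.pi_ne_zero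
    field_simp
    ring
  · simp [chirp, hu]

theorem norm_guideStar {c₀ t_g : ℝ} (hc₀ : 0 < c₀) (ht_g : 0 < t_g) :
    ‖guideStar c₀ t_g‖ = c₀ * t_g := by
  rw [EuclideanSpace.norm_eq, guideStar, Fin.sum_univ_three]
  simp [abs_of_pos hc₀, abs_of_pos ht_g]
  exact Real.sqrt_sq (mul_pos hc₀ ht_g).le

/-- The rate of the quadratic phase caused by the speed mismatch. -/
noncomputable def mismatchRate (a₀ ω₀ c₀ t_g c_s : ℝ) : ℝ :=
  -a₀ ^ 2 * ω₀ / (c₀ * ‖guideStar c₀ t_g‖) * ((c₀ / c_s) ^ 2 - 1)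

theorem mismatchRate_self {a₀ ω₀ c₀ t_g : ℝ} (hc₀ : 0 < c₀) :
    mismatchRate a₀ ω₀ c₀ t_g c₀ = 0 := by
  simp [mismatchRate, div_self hc₀.ne']

theorem mismatchRate_ne_zero {a₀ ω₀ c₀ t_g c_s : ℝ} (ha₀ : 0 < a₀) (hω₀ : 0 < ω₀)
    (hc₀ : 0 < c₀) (ht_g : 0 < t_g) (hc_s : 0 < c_s) (hne : c_s ≠ c₀) :
    mismatchRate a₀ ω₀ c₀ t_g c_s ≠ 0 := by
  have h1 : -a₀ ^ 2 * ω₀ / (c₀ * ‖guideStar c₀ t_g‖) ≠ 0 := by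
    rw [norm_guideStar hc₀ ht_g, neg_mul, neg_div, neg_ne_zero]
    positivity
  refine mul_ne_zero h1 fun h => hne ?_
  have h2 : c₀ / c_s = 1 := (pow_eq_one_iff_of_nonneg (by positivity) two_ne_zero).1 (sub_eq_zero.1 h)
  exact ((div_eq_one_iff_eq hc_s.ne').1 h2).symm

/-- The transverse frequency, in cycles, per unit of the transverse variable. -/
noncomputable def transverseScale (a₀ ω₀ c₀ t_g : ℝ) : ℝ :=
  a₀ * ω₀ / (c₀ * ‖guideStar c₀ t_g‖) / (2 * Real.pi)

/-- The factor of `momentIntegrand` that depends on the transverse variables only. -/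
noncomputable def transverseFactor (A₀ : Set (EuclideanSpace ℝ (Fin 2))) (a₀ ω₀ c₀ t_g c_s : ℝ)
    (x : EuclideanSpace ℝ (Fin 2)) : ℝ :=
  (volume.real A₀)⁻¹ ^ 4 *
    ‖𝓕 (chirp A₀ (mismatchRate a₀ ω₀ c₀ t_g c_s)) (transverseScale a₀ ω₀ c₀ t_g • x)‖ ^ 4

/-- The shear that straightens the parabolic range coordinate. -/
noncomputable def rangeShear (c₀ t_g : ℝ) (η : EuclideanSpace ℝ (Fin 2) × ℝ) : EuclideanSpace ℝ (Fin 2) × ℝ :=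
  (η.1, η.2 + (η.1 0 ^ 2 + η.1 1 ^ 2) / ‖guideStar c₀ t_g‖ / 2)

theorem measurePreserving_rangeShear (c₀ t_g : ℝ) :
    MeasurePreserving (rangeShear c₀ t_g) volume volume := by
  refine MeasurePreserving.skew_product (MeasurePreserving.id volume)
    (g := fun (x : EuclideanSpace ℝ (Fin 2)) (y : ℝ) => y + (x 0 ^ 2 + x 1 ^ 2) / ‖guideStar c₀ t_g‖ / 2) ?_ (ae_of_all _ fun x => ?_)
  · have : Continuous fun p : EuclideanSpace ℝ (Fin 2) × ℝ =>
        p.2 + (p.1 0 ^ 2 + p.1 1 ^ 2) / ‖guideStar c₀ t_g‖ / 2 := by fun_prop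
    exact this.measurable
  · exact map_add_right_eq_self volume _

variable {A₀ : Set (EuclideanSpace ℝ (Fin 2))} {F₀ : ℝ → ℂ} {a₀ ω₀ B_H c₀ t_g : ℝ}

/-- In the sheared coordinates the integrand is a product, and only its transverse factor involves
`c_s`. -/
theorem momentIntegrand_eq_comp_rangeShear (hA₀ : MeasurableSet A₀) (c_s : ℝ) :
    momentIntegrand A₀ F₀ a₀ ω₀ B_H c₀ t_g c_s =
      (fun p => transverseFactor A₀ a₀ ω₀ c₀ t_g c_s p.1 * ‖F₀ (2 * B_H / c₀ * p.2)‖ ^ 2) ∘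
        rangeShear c₀ t_g := by
  ext η
  have hR : B_H / c₀ * (2 * η.2 + (η.1 0 ^ 2 + η.1 1 ^ 2) / ‖guideStar c₀ t_g‖) =
      2 * B_H / c₀ * (η.2 + (η.1 0 ^ 2 + η.1 1 ^ 2) / ‖guideStar c₀ t_g‖ / 2) := by ring
  simp only [momentIntegrand, Function.comp_apply, rangeShear, transverseFactor]
  rw [hR, pointSpread_eq_fourier_chirp hA₀, norm_mul, mul_pow, mul_comm]
  simp [mismatchRate, transverseScale]

theorem transverseScale_pos (ha₀ : 0 < a₀) (hω₀ : 0 < ω₀) (hc₀ : 0 < c₀) (ht_g : 0 < t_g) :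
    0 < transverseScale a₀ ω₀ c₀ t_g := by
  rw [transverseScale, norm_guideStar hc₀ ht_g]
  positivity

theorem integrable_transverseFactor (hA₀ : MeasurableSet A₀) (hA₀_fin : volume A₀ ≠ ⊤)
    (ha₀ : 0 < a₀) (hω₀ : 0 < ω₀) (hc₀ : 0 < c₀) (ht_g : 0 < t_g) (c_s : ℝ) :
    Integrable (transverseFactor A₀ a₀ ω₀ c₀ t_g c_s) :=
  ((integrable_norm_fourier_chirp_pow_four hA₀ hA₀_fin _).comp_smul
    (transverseScale_pos ha₀ hω₀ hc₀ ht_g).ne').const_mul _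

theorem integral_transverseFactor (c_s : ℝ) :
    ∫ x, transverseFactor A₀ a₀ ω₀ c₀ t_g c_s x =
      (volume.real A₀)⁻¹ ^ 4 * |(transverseScale a₀ ω₀ c₀ t_g ^ 2)⁻¹| *
        ∫ ξ, ‖𝓕 (chirp A₀ (mismatchRate a₀ ω₀ c₀ t_g c_s)) ξ‖ ^ 4 := by
  have h := Measure.integral_comp_smul volume
    (fun ξ => ‖𝓕 (chirp A₀ (mismatchRate a₀ ω₀ c₀ t_g c_s)) ξ‖ ^ 4)
    (transverseScale a₀ ω₀ c₀ t_g)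
  simp only [transverseFactor, integral_const_mul]
  rw [h, finrank_euclideanSpace_fin, smul_eq_mul, mul_assoc]

theorem integrable_rangeFactor (hF₀ : MemLp F₀ 2 volume) (hB_H : 0 < B_H) (hc₀ : 0 < c₀) :
    Integrable fun y : ℝ => ‖F₀ (2 * B_H / c₀ * y)‖ ^ 2 :=
  ((memLp_two_iff_integrable_sq_norm hF₀.1).1 hF₀).comp_mul_left' (by positivity)

theorem integral_rangeFactor_pos (hF₀ : MemLp F₀ 2 volume) (hF₀_ne : ¬ F₀ =ᵐ[volume] 0)
    (hB_H : 0 < B_H) (hc₀ : 0 < c₀) : 0 < ∫ y : ℝ, ‖F₀ (2 * B_H / c₀ * y)‖ ^ 2 := by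
  rw [Measure.integral_comp_mul_left (fun y => ‖F₀ y‖ ^ 2), smul_eq_mul]
  have h : 0 < ∫ y, ‖F₀ y‖ ^ 2 := by
    refine (integral_nonneg fun y => by positivity).lt_of_ne' fun h => hF₀_ne ?_
    filter_upwards [(integral_eq_zero_iff_of_nonneg (fun y => by positivity)
      ((memLp_two_iff_integrable_sq_norm hF₀.1).1 hF₀)).1 h] with y hy
    simpa using hy
  positivity

theorem integrable_momentIntegrand (hA₀ : MeasurableSet A₀) (hA₀_fin : volume A₀ ≠ ⊤)
    (hF₀ : MemLp F₀ 2 volume) (ha₀ : 0 < a₀) (hω₀ : 0 < ω₀) (hB_H : 0 < B_H) (hc₀ : 0 < c₀)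
    (ht_g : 0 < t_g) (c_s : ℝ) :
    Integrable (momentIntegrand A₀ F₀ a₀ ω₀ B_H c₀ t_g c_s) := by
  rw [momentIntegrand_eq_comp_rangeShear hA₀]
  exact (measurePreserving_rangeShear c₀ t_g).integrable_comp_of_integrable
    ((integrable_transverseFactor hA₀ hA₀_fin ha₀ hω₀ hc₀ ht_g c_s).mul_prod
      (integrable_rangeFactor hF₀ hB_H hc₀))

theorem integral_momentIntegrand (hA₀ : MeasurableSet A₀) (hA₀_fin : volume A₀ ≠ ⊤)
    (hF₀ : MemLp F₀ 2 volume) (ha₀ : 0 < a₀) (hω₀ : 0 < ω₀) (hB_H : 0 < B_H) (hc₀ : 0 < c₀)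
    (ht_g : 0 < t_g) (c_s : ℝ) :
    ∫ η, momentIntegrand A₀ F₀ a₀ ω₀ B_H c₀ t_g c_s η =
      (∫ x, transverseFactor A₀ a₀ ω₀ c₀ t_g c_s x) * ∫ y, ‖F₀ (2 * B_H / c₀ * y)‖ ^ 2 := by
  have hint := (integrable_transverseFactor hA₀ hA₀_fin ha₀ hω₀ hc₀ ht_g c_s).mul_prod
    (integrable_rangeFactor hF₀ hB_H hc₀)
  have hT := measurePreserving_rangeShear c₀ t_g
  rw [momentIntegrand_eq_comp_rangeShear hA₀, ← integral_prod_mul, ← Measure.volume_eq_prod]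
  -- Writing the volume as its own image under the shear lets `integral_map` supply the change of
  -- variables.
  conv_rhs => rw [← hT.map_eq]
  rw [integral_map hT.aemeasurable (by rw [hT.map_eq]; exact hint.1)]
  rfl

theorem secondMoment_lt (hA₀ : MeasurableSet A₀) (hA₀_pos : volume A₀ ≠ 0)
    (hA₀_fin : volume A₀ ≠ ⊤) (hF₀ : MemLp F₀ 2 volume) (hF₀_ne : ¬ F₀ =ᵐ[volume] 0) {κ : ℝ}
    (hκ : 0 < κ) (ha₀ : 0 < a₀) (hω₀ : 0 < ω₀) (hB_H : 0 < B_H) (hc₀ : 0 < c₀) (ht_g : 0 < t_g)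
    {c_s : ℝ} (hc_s : 0 < c_s) (hne : c_s ≠ c₀) :
    secondMoment κ A₀ F₀ a₀ ω₀ B_H c₀ t_g c_s < secondMoment κ A₀ F₀ a₀ ω₀ B_H c₀ t_g c₀ := by
  have hF := integral_rangeFactor_pos hF₀ hF₀_ne hB_H hc₀
  have hA : 0 < volume.real A₀ := ENNReal.toReal_pos hA₀_pos hA₀_fin
  have hk := transverseScale_pos ha₀ hω₀ hc₀ ht_g
  simp only [secondMoment,
    integral_momentIntegrand hA₀ hA₀_fin hF₀ ha₀ hω₀ hB_H hc₀ ht_g, integral_transverseFactor,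
    mismatchRate_self hc₀]
  have h := integral_norm_fourier_chirp_pow_four_lt hA₀ hA₀_pos hA₀_fin
    (mismatchRate_ne_zero ha₀ hω₀ hc₀ ht_g hc_s hne)
  gcongr

end DaylightImaging

theorem mainTheorem7
    (A₀ : Set (EuclideanSpace ℝ (Fin 2))) (hA₀ : MeasurableSet A₀)
    (hA₀_pos : volume A₀ ≠ 0) (hA₀_fin : volume A₀ ≠ ⊤)
    (F₀ : ℝ → ℂ) (hF₀ : MemLp F₀ 2 volume) (hF₀_ne : ¬ F₀ =ᵐ[volume] 0)
    (κ a₀ ω₀ B_H c₀ t_g : ℝ) (hκ : 0 < κ) (ha₀ : 0 < a₀) (hω₀ : 0 < ω₀) (hB_H : 0 < B_H)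
    (hc₀ : 0 < c₀) (ht_g : 0 < t_g) :
    (∀ c_s : ℝ, 0 < c_s →
      Integrable (DaylightImaging.momentIntegrand A₀ F₀ a₀ ω₀ B_H c₀ t_g c_s) volume) ∧
    DaylightImaging.argmaxOn
      (fun c_s : ℝ => DaylightImaging.secondMoment κ A₀ F₀ a₀ ω₀ B_H c₀ t_g c_s)
      (Set.Ioi 0) = {c₀} := by
  refine ⟨fun c_s _ => DaylightImaging.integrable_momentIntegrand hA₀ hA₀_fin hF₀ ha₀ hω₀ hB_H
    hc₀ ht_g c_s, Set.Subset.antisymm (fun x hx => ?_) ?_⟩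
  · by_contra hne
    exact (DaylightImaging.secondMoment_lt hA₀ hA₀_pos hA₀_fin hF₀ hF₀_ne hκ ha₀ hω₀ hB_H hc₀
      ht_g hx.1 hne).not_ge (hx.2 (Set.mem_Ioi.2 hc₀))
  · refine Set.singleton_subset_iff.2 ⟨hc₀, fun x hx => ?_⟩
    rcases eq_or_ne x c₀ with heq | hne
    · exact (congrArg (DaylightImaging.secondMoment κ A₀ F₀ a₀ ω₀ B_H c₀ t_g) heq).le
    · exact (DaylightImaging.secondMoment_lt hA₀ hA₀_pos hA₀_fin hF₀ hF₀_ne hκ ha₀ hω₀ hB_H hc₀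
        ht_g hx hne).le
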